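/- Let $r$ be a nonnegative integer, $q\in\mathbb C$ with $0<|q|<1$, and write $(x)_\infty=\prod_{j\ge 0}(1-xq^j)$, $(x)_k=\prod_{j=0}^{k-1}(1-xq^j)$ for integers $k\ge 0$, and $(x_1,\dots,x_m)_k=(x_1)_k\cdots(x_m)_k$ for $k\in\{0,1,2,\dots\}\cup\{\infty\}$. Let $a,b_i,c_i,d_i$ $(1\le i\le r)$ be nonzero complex numbers with $a\ne 1$ such that none of $aq^{m+1}/b_i$, $aq^{m+1}/c_i$, $aq^{m+1}/d_i$ $(1\le i\le r,\ m\ge 0)$ equals $1$. If $$\left|\frac{aq^{2-r}}{b_ic_id_i}\right|<1\qquad(1\le i\le r),$$ then the following multiple series converges absolutely and $$\sum_{k_1,\dots,k_r=0}^{\infty}\ \prod_{1\le i<j\le r}(q^{k_i}-q^{k_j})(1-aq^{k_i+k_j})\prod_{i=1}^r\frac{(1-aq^{2k_i})\,(a,b_i,c_i,d_i)_{k_i}}{(1-a)\,(q,aq/b_i,aq/c_i,aq/d_i)_{k_i}}\left(\frac{aq^{2-r}}{b_ic_id_i}\right)^{k_i}$$ $$=q^{-\binom r3}\det_{1\le i,j\le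 r}\left(\frac{(b_i,c_i,d_i)_{r-j}}{(b_ic_id_i/a)_{r-j}}\right)\prod_{i=1}^r\frac{(aq,\,aq/b_ic_i,\,aq/b_id_i,\,aq/c_id_i)_\infty}{(aq/b_i,\,aq/c_i,\,aq/d_i,\,aq/b_ic_id_i)_\infty}.$$ -/

import Mathlib

/-- The infinite `q`-shifted factorial `(a; q)_∞ = ∏_{j ≥ 0} (1 - a q ^ j)`. -/
noncomputable def qPochInf (q a : ℂ) : ℂ := ∏' j : ℕ, (1 - a * q ^ j)

/-- The finite `q`-shifted factorial `(a; q)_k = ∏_{0 ≤ j < k} (1 - a q ^ j)`,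
for natural numbers `k`. -/
def qPoch (q a : ℂ) (k : ℕ) : ℂ := ∏ j ∈ Finset.range k, (1 - a * q ^ j)

/-- The product defining `(a; q)_∞` converges when `|q| < 1`. -/
theorem multipliable_qPochInf {q : ℂ} (hq : ‖q‖ < 1) (a : ℂ) :
    Multipliable fun j : ℕ => 1 - a * q ^ j := by
  have h : Summable fun j : ℕ => -(a * q ^ j) :=
    ((summable_geometric_of_norm_lt_one hq).mul_left a).neg
  simpa [sub_eq_add_neg] using Complex.multipliable_one_add_of_summable h

/-- `(a; q)_k (a q ^ k; q)_∞ = (a; q)_∞`; hence `(a; q)_k` is the usual quotient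
`(a; q)_∞ / (a q ^ k; q)_∞` whenever the denominator does not vanish. -/
theorem qPoch_mul_qPochInf {q : ℂ} (hq : ‖q‖ < 1) (a : ℂ) (k : ℕ) :
    qPoch q a k * qPochInf q (a * q ^ k) = qPochInf q a := by
  have h := multipliable_qPochInf hq (a * q ^ k)
  have h' : Multipliable fun j : ℕ => 1 - a * q ^ (j + k) := by
    refine h.congr fun j => ?_
    ring
  have h2 := Multipliable.prod_mul_tprod_nat_mul' (f := fun j : ℕ => 1 - a * q ^ j) h'
  rw [qPochInf, qPochInf, qPoch, ← h2]
  congr 2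
  funext j
  ring

/-- The summand, at the multi-index `k`, of the very-well-poised `C_r` `₆φ₅` series. -/
noncomputable def cr65Term (r : ℕ) (q a : ℂ) (b c d : Fin r → ℂ) (k : Fin r → ℕ) : ℂ :=
  (∏ i : Fin r, ∏ j ∈ Finset.Ioi i,
      (q ^ k i - q ^ k j) * (1 - a * q ^ (k i + k j))) *
  ∏ i : Fin r,
    (1 - a * q ^ (2 * k i)) *
        (qPoch q a (k i) * qPoch q (b i) (k i) * qPoch q (c i) (k i) * qPoch q (d i) (k i)) /
      ((1 - a) *
        (qPoch q q (k i) * qPoch q (a * q / b i) (k i) * qPoch q (a * q / c i) (k i) *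
          qPoch q (a * q / d i) (k i))) *
      (a * q ^ (2 - (r : ℤ)) / (b i * c i * d i)) ^ k i

open Filter Topology

/-! Put x_i = q^{k_i}. Up to the row factors x_i^{r-1}, the product of the (x_i - x_j)(1 - a x_i
x_j) is a Vandermonde determinant in y_i = -(x_i⁻¹ + a x_i). Powers of y_i may be replaced by monic
polynomials of the same degree, so for n = r-1-j the entry can be taken to be (a x_i)_n ∏_{m<n}(x_i
- q^m) / x_i^n, at the cost of q^{-binom(r,3)} (`prod_sub_mul_eq_det`). Row i involves only k_i, so
the multiple sum is a determinant of single sums (`hasSum_det`). In a single sum the entry kills the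
terms k < n, and k = n + l leaves a `₆φ₅` series with a, b, c, d replaced by aq^{2n}, bq^n, cq^n,
dq^n (`vwpTerm_add`).

The `₆φ₅` sum (`tsum_vwpTerm`) is proved with inverse parameters β = 1/b, γ = 1/c, δ = 1/d.
Telescoping relates δ to δq, and iteration drives δ to 0; by symmetry so for γ and β. At β = γ = δ =
0 a second telescoping sends a to aq, and the series tends to 1 as a tends to 0. Limits pass through
the sums by dominated convergence. Not dividing by 1 - a keeps the shifted series valid even if
aq^{2n} = 1. -/

/-! ### Shifted factorials: identities, limits and uniform bounds. -/

theorem qPoch_zero_right (q x : ℂ) : qPoch q x 0 = 1 := by simp [qPoch]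

theorem qPoch_succ (q x : ℂ) (k : ℕ) : qPoch q x (k + 1) = qPoch q x k * (1 - x * q ^ k) := by
  simp [qPoch, Finset.prod_range_succ]

theorem qPoch_zero_left (q : ℂ) (k : ℕ) : qPoch q 0 k = 1 := by simp [qPoch]

theorem qPoch_add (q x : ℂ) (m n : ℕ) :
    qPoch q x (m + n) = qPoch q x m * qPoch q (x * q ^ m) n := by
  simp only [qPoch, Finset.prod_range_add]
  congr 1
  refine Finset.prod_congr rfl fun j _ => ?_
  ring

theorem qPoch_one_add (q x : ℂ) (n : ℕ) :
    qPoch q x (1 + n) = (1 - x) * qPoch q (x * q) n := by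
  rw [qPoch_add]
  simp [qPoch]

theorem qPoch_ne_zero {q x : ℂ} (h : ∀ m : ℕ, x * q ^ m ≠ 1) (k : ℕ) : qPoch q x k ≠ 0 :=
  Finset.prod_ne_zero_iff.2 fun j _ => sub_ne_zero.2 (h j).symm

theorem tendsto_qPoch {q : ℂ} (hq : ‖q‖ < 1) (x : ℂ) :
    Tendsto (qPoch q x) atTop (𝓝 (qPochInf q x)) :=
  (multipliable_qPochInf hq x).hasProd.tendsto_prod_nat

theorem qPochInf_zero (q : ℂ) : qPochInf q 0 = 1 := by simp [qPochInf]

theorem qPochInf_ne_zero {q x : ℂ} (hq : ‖q‖ < 1) (h : ∀ m : ℕ, x * q ^ m ≠ 1) :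
    qPochInf q x ≠ 0 := by
  have hs : Summable fun j : ℕ => ‖-(x * q ^ j)‖ :=
    ((summable_geometric_of_norm_lt_one hq).mul_left x).neg.norm
  have := tprod_one_add_ne_zero_of_summable (f := fun j : ℕ => -(x * q ^ j))
    (fun j => by
      rw [← sub_eq_add_neg]
      exact sub_ne_zero.2 (h j).symm) hs
  simpa [qPochInf, sub_eq_add_neg] using this

theorem mul_pow_ne_one_of_norm_lt_one {q x : ℂ} (hq : ‖q‖ < 1) (hx : ‖x‖ < 1) (m : ℕ) :
    x * q ^ m ≠ 1 := by
  intro h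
  have h1 : ‖x * q ^ m‖ = 1 := by rw [h, norm_one]
  rw [norm_mul, norm_pow] at h1
  have h2 : ‖q‖ ^ m ≤ 1 := pow_le_one₀ (norm_nonneg _) hq.le
  nlinarith [norm_nonneg x, norm_nonneg q]

theorem sum_range_pow_le {s : ℝ} (h0 : 0 ≤ s) (h1 : s < 1) (k : ℕ) :
    ∑ j ∈ Finset.range k, s ^ j ≤ (1 - s)⁻¹ := by
  rw [← tsum_geometric_of_lt_one h0 h1]
  exact (summable_geometric_of_lt_one h0 h1).sum_le_tsum _ fun j _ => pow_nonneg h0 j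

theorem prod_one_add_geometric_le {s X : ℝ} (h0 : 0 ≤ s) (h1 : s < 1) (hX : 0 ≤ X) (k : ℕ) :
    ∏ j ∈ Finset.range k, (1 + X * s ^ j) ≤ Real.exp (X * (1 - s)⁻¹) := by
  calc ∏ j ∈ Finset.range k, (1 + X * s ^ j)
      ≤ ∏ j ∈ Finset.range k, Real.exp (X * s ^ j) :=
        Finset.prod_le_prod (fun j _ => by positivity) fun j _ => by
          linarith [Real.add_one_le_exp (X * s ^ j)]
    _ = Real.exp (X * ∑ j ∈ Finset.range k, s ^ j) := by
        rw [← Real.exp_sum, Finset.mul_sum]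
    _ ≤ _ := Real.exp_le_exp.2 (mul_le_mul_of_nonneg_left (sum_range_pow_le h0 h1 k) hX)

theorem norm_qPoch_le {q x : ℂ} {X : ℝ} (hq : ‖q‖ < 1) (hx : ‖x‖ ≤ X) (k : ℕ) :
    ‖qPoch q x k‖ ≤ Real.exp (X * (1 - ‖q‖)⁻¹) := by
  refine le_trans ?_ (prod_one_add_geometric_le (norm_nonneg q) hq ((norm_nonneg x).trans hx) k)
  rw [qPoch, norm_prod]
  refine Finset.prod_le_prod (fun j _ => norm_nonneg _) fun j _ => ?_
  refine (norm_sub_le _ _).trans ?_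
  rw [norm_one, norm_mul, norm_pow]
  gcongr

/-- The infinite product is nonzero, so the reciprocals converge and are bounded. -/
theorem exists_pos_le_norm_qPoch {q x : ℂ} (hq : ‖q‖ < 1) (h : ∀ m : ℕ, x * q ^ m ≠ 1) :
    ∃ c : ℝ, 0 < c ∧ ∀ k, c ≤ ‖qPoch q x k‖ := by
  have ht : Tendsto (fun k => ‖qPoch q x k‖⁻¹) atTop (𝓝 ‖qPochInf q x‖⁻¹) :=
    (tendsto_qPoch hq x).norm.inv₀ (norm_ne_zero_iff.2 (qPochInf_ne_zero hq h))
  obtain ⟨M, hM⟩ := ht.bddAbove_range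
  have hM' : ∀ k, ‖qPoch q x k‖⁻¹ ≤ M := fun k => hM ⟨k, rfl⟩
  have hp : ∀ k, 0 < ‖qPoch q x k‖ := fun k => norm_pos_iff.2 (qPoch_ne_zero h k)
  have hMpos : 0 < M := (inv_pos.2 (hp 0)).trans_le (hM' 0)
  exact ⟨M⁻¹, inv_pos.2 hMpos, fun k => inv_le_of_inv_le₀ (hp k) (hM' k)⟩

/-- Uniformity in `N` comes from 1/(xq^N)_k = (x)_N/(x)_{N+k}; it is needed when δ is replaced by
δq^N. -/
theorem exists_norm_inv_qPoch_shift_le {q x : ℂ} (hq : ‖q‖ < 1) (h : ∀ m : ℕ, x * q ^ m ≠ 1) :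
    ∃ C : ℝ, 0 ≤ C ∧ ∀ N k : ℕ, ‖(qPoch q (x * q ^ N) k)⁻¹‖ ≤ C := by
  obtain ⟨c, hc, hle⟩ := exists_pos_le_norm_qPoch hq h
  refine ⟨Real.exp (‖x‖ * (1 - ‖q‖)⁻¹) * c⁻¹, by positivity, fun N k => ?_⟩
  have h1 : (qPoch q (x * q ^ N) k)⁻¹ = qPoch q x N * (qPoch q x (N + k))⁻¹ := by
    rw [qPoch_add, mul_inv, mul_inv_cancel_left₀ (qPoch_ne_zero h N)]
  rw [h1, norm_mul, norm_inv]
  have h2 := norm_qPoch_le hq (le_refl ‖x‖) N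
  have h3 : ‖qPoch q x (N + k)‖⁻¹ ≤ c⁻¹ := inv_anti₀ hc (hle _)
  gcongr

/-! ### The very-well-poised term and its geometric majorants. -/

/-- The product `∏_{0 ≤ j < k} (x - q ^ j)`, which is `x ^ k (x⁻¹; q)_k` for `x ≠ 0`. -/
def qFall (q x : ℂ) (k : ℕ) : ℂ := ∏ j ∈ Finset.range k, (x - q ^ j)

theorem qFall_succ (q x : ℂ) (k : ℕ) : qFall q x (k + 1) = qFall q x k * (x - q ^ k) := by
  simp [qFall, Finset.prod_range_succ]

theorem qFall_mul_succ (q x : ℂ) (k : ℕ) :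
    qFall q (x * q) (k + 1) = q ^ k * (x * q - 1) * qFall q x k := by
  simp only [qFall]
  rw [Finset.prod_range_succ', pow_zero, Finset.prod_congr rfl
    fun j _ => show x * q - q ^ (j + 1) = q * (x - q ^ j) by ring, Finset.prod_mul_distrib]
  simp only [Finset.prod_const, Finset.card_range]
  ring

theorem qFall_inv {x : ℂ} (q : ℂ) (hx : x ≠ 0) (k : ℕ) :
    qFall q x⁻¹ k = qPoch q x k / x ^ k := by
  induction k with
  | zero => simp [qFall, qPoch]
  | succ k ih =>
    rw [qFall_succ, qPoch_succ, ih]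
    field_simp
    ring

/-- Each factor is at most D(1 + D⁻¹|q|^j). A free `D > 0` in place of `‖x‖` covers `x = 0`. -/
theorem norm_qFall_le {q x : ℂ} {D : ℝ} (hq : ‖q‖ < 1) (hD : 0 < D) (hx : ‖x‖ ≤ D) (k : ℕ) :
    ‖qFall q x k‖ ≤ D ^ k * Real.exp (D⁻¹ * (1 - ‖q‖)⁻¹) := by
  have h1 : ‖qFall q x k‖ ≤ ∏ j ∈ Finset.range k, (D * (1 + D⁻¹ * ‖q‖ ^ j)) := by
    rw [qFall, norm_prod]
    refine Finset.prod_le_prod (fun j _ => norm_nonneg _) fun j _ => ?_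
    refine (norm_sub_le _ _).trans ?_
    rw [norm_pow, mul_add, mul_inv_cancel_left₀ hD.ne', mul_one]
    gcongr
  refine h1.trans ?_
  rw [Finset.prod_mul_distrib, Finset.prod_const, Finset.card_range]
  exact mul_le_mul_of_nonneg_left
    (prod_one_add_geometric_le (norm_nonneg q) hq (by positivity) k) (by positivity)

/-- Each modulus is enlarged by an ε so small that ρ = |aq|(|β|+ε)(|γ|+ε)(|δ|+ε) is still below 1.
Uniformity in `a'` and `δ'` serves both limits, δ → 0 and a → 0. -/
theorem exists_norm_qFall_mul_le {q a β γ δ : ℂ} (hq : ‖q‖ < 1) (h : ‖a * q * (β * γ * δ)‖ < 1) :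
    ∃ C ρ : ℝ, 0 ≤ C ∧ 0 ≤ ρ ∧ ρ < 1 ∧ ∀ a' δ' : ℂ, ‖a'‖ ≤ ‖a‖ → ‖δ'‖ ≤ ‖δ‖ → ∀ k : ℕ,
      ‖qFall q β k * qFall q γ k * qFall q δ' k * (a' * q) ^ k‖ ≤ C * ρ ^ k := by
  have hc : Tendsto (fun ε : ℝ => ‖a‖ * ‖q‖ * ((‖β‖ + ε) * (‖γ‖ + ε) * (‖δ‖ + ε)))
      (𝓝[>] 0) (𝓝 (‖a‖ * ‖q‖ * ((‖β‖ + 0) * (‖γ‖ + 0) * (‖δ‖ + 0)))) := by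
    refine Tendsto.mono_left ?_ nhdsWithin_le_nhds
    exact Continuous.tendsto (by fun_prop) 0
  have hlt : ‖a‖ * ‖q‖ * ((‖β‖ + 0) * (‖γ‖ + 0) * (‖δ‖ + 0)) < 1 := by
    simpa [norm_mul] using h
  obtain ⟨ε, hε, hε0⟩ := ((hc.eventually_lt_const hlt).and self_mem_nhdsWithin).exists
  replace hε0 : 0 < ε := hε0
  refine ⟨Real.exp ((‖β‖ + ε)⁻¹ * (1 - ‖q‖)⁻¹) * Real.exp ((‖γ‖ + ε)⁻¹ * (1 - ‖q‖)⁻¹) *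
    Real.exp ((‖δ‖ + ε)⁻¹ * (1 - ‖q‖)⁻¹), _, by positivity, by positivity, hε,
    fun a' δ' ha' hδ' k => ?_⟩
  have h1 := norm_qFall_le (x := β) (D := ‖β‖ + ε) hq (by positivity) (by linarith) k
  have h2 := norm_qFall_le (x := γ) (D := ‖γ‖ + ε) hq (by positivity) (by linarith) k
  have h3 := norm_qFall_le (x := δ') (D := ‖δ‖ + ε) hq (by positivity) (by linarith) k
  calc ‖qFall q β k * qFall q γ k * qFall q δ' k * (a' * q) ^ k‖
      = ‖qFall q β k‖ * ‖qFall q γ k‖ * ‖qFall q δ' k‖ * (‖a'‖ * ‖q‖) ^ k := by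
        simp only [norm_mul, norm_pow]
    _ ≤ ((‖β‖ + ε) ^ k * Real.exp ((‖β‖ + ε)⁻¹ * (1 - ‖q‖)⁻¹)) *
        ((‖γ‖ + ε) ^ k * Real.exp ((‖γ‖ + ε)⁻¹ * (1 - ‖q‖)⁻¹)) *
        ((‖δ‖ + ε) ^ k * Real.exp ((‖δ‖ + ε)⁻¹ * (1 - ‖q‖)⁻¹)) * (‖a‖ * ‖q‖) ^ k := by
        gcongr
    _ = _ := by
        simp only [mul_pow]
        ring

/-- The `k`-th term of the nonterminating very-well-poised `₆φ₅` series with parameters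
`a, β⁻¹, γ⁻¹, δ⁻¹` multiplied by `1 - a`, in a form that makes sense for vanishing
`β`, `γ`, `δ`. -/
noncomputable def vwpTerm (q a β γ δ : ℂ) (k : ℕ) : ℂ :=
  (1 - a * q ^ (2 * k)) * qPoch q a k * (qPoch q q k)⁻¹ *
    ((qPoch q (a * q * β) k)⁻¹ * (qPoch q (a * q * γ) k)⁻¹ * (qPoch q (a * q * δ) k)⁻¹) *
    (qFall q β k * qFall q γ k * qFall q δ k * (a * q) ^ k)

theorem vwpTerm_swap₁₂ (q a β γ δ : ℂ) : vwpTerm q a β γ δ = vwpTerm q a γ β δ := by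
  funext k
  simp only [vwpTerm]
  ring

theorem vwpTerm_swap₂₃ (q a β γ δ : ℂ) : vwpTerm q a β γ δ = vwpTerm q a β δ γ := by
  funext k
  simp only [vwpTerm]
  ring

theorem self_mul_pow_ne_one {q : ℂ} (hq : ‖q‖ < 1) (m : ℕ) : q * q ^ m ≠ 1 :=
  mul_pow_ne_one_of_norm_lt_one hq hq m

theorem norm_mul_pow_le {q : ℂ} (hq : ‖q‖ < 1) (x : ℂ) (N : ℕ) : ‖x * q ^ N‖ ≤ ‖x‖ := by
  rw [norm_mul, norm_pow]
  exact mul_le_of_le_one_right (norm_nonneg _) (pow_le_one₀ (norm_nonneg _) hq.le)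

theorem exists_norm_vwpTerm_le {q a β γ δ : ℂ} (hq : ‖q‖ < 1)
    (hβ : ∀ m : ℕ, a * q * β * q ^ m ≠ 1) (hγ : ∀ m : ℕ, a * q * γ * q ^ m ≠ 1)
    (hδ : ∀ m : ℕ, a * q * δ * q ^ m ≠ 1) (h : ‖a * q * (β * γ * δ)‖ < 1) :
    ∃ C ρ : ℝ, 0 ≤ C ∧ 0 ≤ ρ ∧ ρ < 1 ∧
      ∀ N k : ℕ, ‖vwpTerm q a β γ (δ * q ^ N) k‖ ≤ C * ρ ^ k := by
  obtain ⟨C, ρ, hC, hρ, hρ1, hle⟩ := exists_norm_qFall_mul_le hq h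
  obtain ⟨C₀, hC₀, h₀⟩ := exists_norm_inv_qPoch_shift_le hq (self_mul_pow_ne_one hq)
  obtain ⟨C₁, hC₁, h₁⟩ := exists_norm_inv_qPoch_shift_le hq hβ
  obtain ⟨C₂, hC₂, h₂⟩ := exists_norm_inv_qPoch_shift_le hq hγ
  obtain ⟨C₃, hC₃, h₃⟩ := exists_norm_inv_qPoch_shift_le hq hδ
  refine ⟨(1 + ‖a‖) * Real.exp (‖a‖ * (1 - ‖q‖)⁻¹) * C₀ * (C₁ * C₂ * C₃) * C, ρ,
    by positivity, hρ, hρ1, fun N k => ?_⟩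
  have e0 : ‖1 - a * q ^ (2 * k)‖ ≤ 1 + ‖a‖ := by
    refine (norm_sub_le _ _).trans ?_
    rw [norm_one]
    linarith [norm_mul_pow_le hq a (2 * k)]
  have e1 := norm_qPoch_le hq (le_refl ‖a‖) k
  have e2 : ‖(qPoch q q k)⁻¹‖ ≤ C₀ := by simpa using h₀ 0 k
  have e3 : ‖(qPoch q (a * q * β) k)⁻¹‖ ≤ C₁ := by simpa using h₁ 0 k
  have e4 : ‖(qPoch q (a * q * γ) k)⁻¹‖ ≤ C₂ := by simpa using h₂ 0 k
  have e5 : ‖(qPoch q (a * q * (δ * q ^ N)) k)⁻¹‖ ≤ C₃ := by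
    rw [← mul_assoc]
    exact h₃ N k
  have e6 := hle a (δ * q ^ N) le_rfl (norm_mul_pow_le hq δ N) k
  rw [vwpTerm, mul_assoc _ C]
  simp only [norm_mul _ (qFall q β k * qFall q γ k * qFall q (δ * q ^ N) k * (a * q) ^ k),
    norm_mul (_ * _) (_ * (qPoch q (a * q * (δ * q ^ N)) k)⁻¹), norm_mul _ (qPoch q q k)⁻¹,
    norm_mul _ (qPoch q a k), norm_mul _ (qPoch q (a * q * (δ * q ^ N)) k)⁻¹,
    norm_mul _ (qPoch q (a * q * γ) k)⁻¹]
  gcongr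

theorem summable_norm_vwpTerm {q a β γ δ : ℂ} (hq : ‖q‖ < 1)
    (hβ : ∀ m : ℕ, a * q * β * q ^ m ≠ 1) (hγ : ∀ m : ℕ, a * q * γ * q ^ m ≠ 1)
    (hδ : ∀ m : ℕ, a * q * δ * q ^ m ≠ 1) (h : ‖a * q * (β * γ * δ)‖ < 1) :
    Summable fun k => ‖vwpTerm q a β γ δ k‖ := by
  obtain ⟨C, ρ, -, hρ, hρ1, hle⟩ := exists_norm_vwpTerm_le hq hβ hγ hδ h
  refine Summable.of_nonneg_of_le (fun k => norm_nonneg _) (fun k => ?_)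
    ((summable_geometric_of_lt_one hρ hρ1).mul_left C)
  simpa using hle 0 k

theorem tendsto_qFall {q : ℂ} (hq : ‖q‖ < 1) (x : ℂ) (k : ℕ) :
    Tendsto (fun N : ℕ => qFall q (x * q ^ N) k) atTop (𝓝 (qFall q 0 k)) := by
  have hN : Tendsto (fun N : ℕ => x * q ^ N) atTop (𝓝 0) := by
    simpa using (tendsto_pow_atTop_nhds_zero_of_norm_lt_one hq).const_mul x
  have hc : Continuous fun y => qFall q y k := by
    unfold qFall
    fun_prop
  exact (hc.tendsto 0).comp hN

theorem tendsto_qPoch_shift {q : ℂ} (hq : ‖q‖ < 1) (x : ℂ) (k : ℕ) :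
    Tendsto (fun N : ℕ => qPoch q (x * q ^ N) k) atTop (𝓝 1) := by
  have hN : Tendsto (fun N : ℕ => x * q ^ N) atTop (𝓝 0) := by
    simpa using (tendsto_pow_atTop_nhds_zero_of_norm_lt_one hq).const_mul x
  have hc : Continuous fun y => qPoch q y k := by
    unfold qPoch
    fun_prop
  rw [← qPoch_zero_left q k]
  exact (hc.tendsto 0).comp hN

theorem tendsto_tsum_vwpTerm {q a β γ δ : ℂ} (hq : ‖q‖ < 1)
    (hβ : ∀ m : ℕ, a * q * β * q ^ m ≠ 1) (hγ : ∀ m : ℕ, a * q * γ * q ^ m ≠ 1)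
    (hδ : ∀ m : ℕ, a * q * δ * q ^ m ≠ 1) (h : ‖a * q * (β * γ * δ)‖ < 1) :
    Tendsto (fun N : ℕ => ∑' k, vwpTerm q a β γ (δ * q ^ N) k) atTop
      (𝓝 (∑' k, vwpTerm q a β γ 0 k)) := by
  obtain ⟨C, ρ, -, hρ, hρ1, hle⟩ := exists_norm_vwpTerm_le hq hβ hγ hδ h
  refine tendsto_tsum_of_dominated_convergence (bound := fun k => C * ρ ^ k)
    ((summable_geometric_of_lt_one hρ hρ1).mul_left C) (fun k => ?_)
    (Eventually.of_forall fun N k => hle N k)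
  have h1 : Tendsto (fun N : ℕ => qPoch q (a * q * (δ * q ^ N)) k) atTop (𝓝 1) := by
    simpa only [mul_assoc] using tendsto_qPoch_shift hq (a * q * δ) k
  have h2 := tendsto_qFall hq δ k
  simp only [vwpTerm, mul_zero, qPoch_zero_left]
  exact ((tendsto_const_nhds.mul (h1.inv₀ one_ne_zero)).const_mul _).mul
    ((h2.const_mul _).mul_const _)

/-! ### The `₆φ₅` summation by telescoping. -/

/-- The induction step of the next telescoping with common factors removed and x = q^K. The new
denominators stay opaque until they are cleared. -/
theorem vwpTerm_certificate (a q x β γ δ : ℂ) {d₀ d₁ d₂ d₃ : ℂ} (h₀ : d₀ ≠ 0) (h₁ : d₁ ≠ 0)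
    (h₂ : d₂ ≠ 0) (h₃ : d₃ ≠ 0) (e₀ : d₀ = 1 - q * x) (e₁ : d₁ = 1 - a * q * β * x)
    (e₂ : d₂ = 1 - a * q * γ * x) (e₃ : d₃ = 1 - a * q * δ * (x * q)) :
    -δ * (1 - a * q * δ) + (1 - a * (x * q) ^ 2) * (1 - a * q * δ) *
        ((1 - a * q * (β * γ * δ)) * (δ - x) -
          (1 - a * q * (β * δ)) * (1 - a * q * (γ * δ)) * (x * (δ * q - 1)) * d₃⁻¹) *
        (d₀⁻¹ * d₁⁻¹ * d₂⁻¹) =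
      -δ * (1 - a * q * δ) * ((1 - a * (x * q)) * (a * q * (β - x * q) * (γ - x * q)) *
        (δ - x)) * (d₀⁻¹ * d₁⁻¹ * d₂⁻¹ * d₃⁻¹) := by
  field_simp
  subst e₀ e₁ e₂ e₃
  ring

/-- The combination of the δ and δq terms has a closed antidifference, which is the right side; it
vanishes as `K` grows, leaving a relation between the two full sums. -/
theorem sum_range_vwpTerm_sub {q a β γ δ : ℂ} (hq : ‖q‖ < 1)
    (hβ : ∀ m : ℕ, a * q * β * q ^ m ≠ 1) (hγ : ∀ m : ℕ, a * q * γ * q ^ m ≠ 1)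
    (hδ : ∀ m : ℕ, a * q * δ * q ^ m ≠ 1) (K : ℕ) :
    ∑ k ∈ Finset.range (K + 1), ((1 - a * q * δ) * (1 - a * q * (β * γ * δ)) *
        vwpTerm q a β γ δ k - (1 - a * q * (β * δ)) * (1 - a * q * (γ * δ)) *
        vwpTerm q a β γ (δ * q) k) =
      -δ * (1 - a * q * δ) * (a * q * (β - q ^ K) * (γ - q ^ K)) *
        (qPoch q a (K + 1) * (qPoch q q K)⁻¹ * ((qPoch q (a * q * β) K)⁻¹ *
        (qPoch q (a * q * γ) K)⁻¹ * (qPoch q (a * q * δ) (K + 1))⁻¹)) *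
        (qFall q β K * qFall q γ K * qFall q δ K * (a * q) ^ K) := by
  have hδ0 : 1 - a * q * δ ≠ 0 := sub_ne_zero.2 (by simpa using (hδ 0).symm)
  induction K with
  | zero =>
    simp [vwpTerm, qPoch, qFall]
    field_simp
    ring
  | succ K ih =>
    rw [Finset.sum_range_succ, ih]
    have m0 : 1 - q * q ^ K ≠ 0 := sub_ne_zero.2 (self_mul_pow_ne_one hq K).symm
    have m1 : 1 - a * q * β * q ^ K ≠ 0 := sub_ne_zero.2 (hβ K).symm
    have m2 : 1 - a * q * γ * q ^ K ≠ 0 := sub_ne_zero.2 (hγ K).symm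
    have m3 : 1 - a * q * δ * q ^ (K + 1) ≠ 0 := sub_ne_zero.2 (hδ (K + 1)).symm
    -- Both denominators are expressed through (aqδ)_{K+1}, so that the two terms share a common
    -- factor.
    have e : (qPoch q (a * q * (δ * q)) (K + 1))⁻¹ =
        (qPoch q (a * q * δ) (K + 1))⁻¹ * (1 - a * q * δ * q ^ (K + 1))⁻¹ *
          (1 - a * q * δ) := by
      rw [← mul_inv, ← qPoch_succ, add_comm (K + 1) 1, qPoch_one_add, mul_inv_rev,
        inv_mul_cancel_right₀ hδ0, ← mul_assoc (a * q)]
    simp only [vwpTerm, e, qFall_mul_succ]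
    simp only [qPoch_succ q a (K + 1), qPoch_succ q q K,
      qPoch_succ q (a * q * β) K, qPoch_succ q (a * q * γ) K, qPoch_succ q (a * q * δ) (K + 1),
      qFall_succ]
    simp only [mul_inv]
    have core := vwpTerm_certificate a q (q ^ K) β γ δ m0 m1 m2 m3 rfl rfl rfl
      (by rw [pow_succ])
    rw [pow_succ q K] at core ⊢
    rw [show q ^ (2 * (K + 1)) = (q ^ K * q) ^ 2 by ring, pow_succ (a * q) K]
    linear_combination (qPoch q a (K + 1) * (qPoch q q K)⁻¹ * ((qPoch q (a * q * β) K)⁻¹ *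
      (qPoch q (a * q * γ) K)⁻¹ * (qPoch q (a * q * δ) (K + 1))⁻¹) *
      (qFall q β K * qFall q γ K * qFall q δ K * (a * q) ^ K) *
      (a * q * (β - q ^ K) * (γ - q ^ K))) * core

theorem mul_shift_pow_ne_one {q x : ℂ} (h : ∀ m : ℕ, x * q ^ m ≠ 1) (N m : ℕ) :
    x * q ^ N * q ^ m ≠ 1 := by
  rw [mul_assoc, ← pow_add]
  exact h _

theorem tendsto_qFall_mul {q a β γ δ : ℂ} (hq : ‖q‖ < 1) (h : ‖a * q * (β * γ * δ)‖ < 1) :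
    Tendsto (fun k => qFall q β k * qFall q γ k * qFall q δ k * (a * q) ^ k) atTop (𝓝 0) := by
  obtain ⟨C, ρ, -, hρ, hρ1, hle⟩ := exists_norm_qFall_mul_le hq h
  refine squeeze_zero_norm (fun k => hle a δ le_rfl le_rfl k) ?_
  simpa using (tendsto_pow_atTop_nhds_zero_of_lt_one hρ hρ1).const_mul C

/-- In the boundary term the shifted factorials have finite limits while the `qFall` product tends
to 0. -/
theorem tsum_vwpTerm_step {q a β γ δ : ℂ} (hq : ‖q‖ < 1)
    (hβ : ∀ m : ℕ, a * q * β * q ^ m ≠ 1) (hγ : ∀ m : ℕ, a * q * γ * q ^ m ≠ 1)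
    (hδ : ∀ m : ℕ, a * q * δ * q ^ m ≠ 1) (h : ‖a * q * (β * γ * δ)‖ < 1) :
    (1 - a * q * δ) * (1 - a * q * (β * γ * δ)) * ∑' k, vwpTerm q a β γ δ k =
      (1 - a * q * (β * δ)) * (1 - a * q * (γ * δ)) * ∑' k, vwpTerm q a β γ (δ * q) k := by
  have hδ' : ∀ m : ℕ, a * q * (δ * q) * q ^ m ≠ 1 := fun m => by
    simpa [mul_assoc] using mul_shift_pow_ne_one hδ 1 m
  have h' : ‖a * q * (β * γ * (δ * q))‖ < 1 := by
    have := norm_mul_pow_le hq (a * q * (β * γ * δ)) 1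
    refine lt_of_le_of_lt (le_of_eq_of_le ?_ this) h
    congr 1
    ring
  have s1 := (summable_norm_vwpTerm hq hβ hγ hδ h).of_norm.hasSum.mul_left
    ((1 - a * q * δ) * (1 - a * q * (β * γ * δ)))
  have s2 := (summable_norm_vwpTerm hq hβ hγ hδ' h').of_norm.hasSum.mul_left
    ((1 - a * q * (β * δ)) * (1 - a * q * (γ * δ)))
  have s3 := (s1.sub s2).tendsto_sum_nat.comp (tendsto_add_atTop_nat 1)
  simp only [Function.comp_def, sum_range_vwpTerm_sub hq hβ hγ hδ] at s3
  have hp : Tendsto (fun K : ℕ => q ^ K) atTop (𝓝 0) :=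
    tendsto_pow_atTop_nhds_zero_of_norm_lt_one hq
  have hs := tendsto_add_atTop_nat 1
  have t1 := ((tendsto_const_nhds (x := a * q)).mul ((tendsto_const_nhds (x := β)).sub hp)).mul
    ((tendsto_const_nhds (x := γ)).sub hp)
  have t2 := ((tendsto_qPoch hq a).comp hs).mul
    ((tendsto_qPoch hq q).inv₀ (qPochInf_ne_zero hq (self_mul_pow_ne_one hq)))
  have t3 := ((tendsto_qPoch hq _).inv₀ (qPochInf_ne_zero hq hβ)).mul
    ((tendsto_qPoch hq _).inv₀ (qPochInf_ne_zero hq hγ))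
  have t4 := t3.mul (((tendsto_qPoch hq _).inv₀ (qPochInf_ne_zero hq hδ)).comp hs)
  have t5 := (((tendsto_const_nhds (x := -δ * (1 - a * q * δ))).mul t1).mul (t2.mul t4)).mul
    (tendsto_qFall_mul hq h)
  rw [mul_zero] at t5
  exact sub_eq_zero.1 (tendsto_nhds_unique s3 t5)

theorem tsum_vwpTerm_iterate {q a β γ δ : ℂ} (hq : ‖q‖ < 1)
    (hβ : ∀ m : ℕ, a * q * β * q ^ m ≠ 1) (hγ : ∀ m : ℕ, a * q * γ * q ^ m ≠ 1)
    (hδ : ∀ m : ℕ, a * q * δ * q ^ m ≠ 1) (h : ‖a * q * (β * γ * δ)‖ < 1) (N : ℕ) :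
    qPoch q (a * q * δ) N * qPoch q (a * q * (β * γ * δ)) N * ∑' k, vwpTerm q a β γ δ k =
      qPoch q (a * q * (β * δ)) N * qPoch q (a * q * (γ * δ)) N *
        ∑' k, vwpTerm q a β γ (δ * q ^ N) k := by
  induction N with
  | zero => simp [qPoch_zero_right]
  | succ N ih =>
    have hδ' : ∀ m : ℕ, a * q * (δ * q ^ N) * q ^ m ≠ 1 := fun m => by
      simpa only [mul_assoc] using mul_shift_pow_ne_one hδ N m
    have h' : ‖a * q * (β * γ * (δ * q ^ N))‖ < 1 := by
      have := norm_mul_pow_le hq (a * q * (β * γ * δ)) N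
      refine lt_of_le_of_lt (le_of_eq_of_le ?_ this) h
      congr 1
      ring
    have step := tsum_vwpTerm_step hq hβ hγ hδ' h'
    rw [mul_assoc δ, ← pow_succ] at step
    simp only [qPoch_succ]
    linear_combination (1 - a * q * δ * q ^ N) * (1 - a * q * (β * γ * δ) * q ^ N) * ih +
      qPoch q (a * q * (β * δ)) N * qPoch q (a * q * (γ * δ)) N * step

theorem tsum_vwpTerm_eq_zero_param {q a β γ δ : ℂ} (hq : ‖q‖ < 1)
    (hβ : ∀ m : ℕ, a * q * β * q ^ m ≠ 1) (hγ : ∀ m : ℕ, a * q * γ * q ^ m ≠ 1)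
    (hδ : ∀ m : ℕ, a * q * δ * q ^ m ≠ 1) (h : ‖a * q * (β * γ * δ)‖ < 1) :
    qPochInf q (a * q * δ) * qPochInf q (a * q * (β * γ * δ)) * ∑' k, vwpTerm q a β γ δ k =
      qPochInf q (a * q * (β * δ)) * qPochInf q (a * q * (γ * δ)) *
        ∑' k, vwpTerm q a β γ 0 k := by
  have t1 := ((tendsto_qPoch hq (a * q * δ)).mul
    (tendsto_qPoch hq (a * q * (β * γ * δ)))).mul_const (∑' k, vwpTerm q a β γ δ k)
  have t2 := ((tendsto_qPoch hq (a * q * (β * δ))).mul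
    (tendsto_qPoch hq (a * q * (γ * δ)))).mul (tendsto_tsum_vwpTerm hq hβ hγ hδ h)
  simp only [tsum_vwpTerm_iterate hq hβ hγ hδ h] at t1
  exact tendsto_nhds_unique t1 t2

/-- The second telescoping, which moves a to aq once the other parameters are gone. -/
theorem sum_range_vwpTerm_zero_sub {q : ℂ} (hq : ‖q‖ < 1) (a : ℂ) (K : ℕ) :
    ∑ k ∈ Finset.range K, (vwpTerm q a 0 0 0 k - (1 - a) * vwpTerm q (a * q) 0 0 0 k) =
      -(qPoch q a K * (qPoch q q K)⁻¹ * (1 - q ^ K)) *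
        (qFall q 0 K * qFall q 0 K * qFall q 0 K * (a * q) ^ K) := by
  induction K with
  | zero => simp
  | succ K ih =>
    rw [Finset.sum_range_succ, ih]
    have m0 : 1 - q * q ^ K ≠ 0 := sub_ne_zero.2 (self_mul_pow_ne_one hq K).symm
    have e : (1 - a) * qPoch q (a * q) K = qPoch q a K * (1 - a * q ^ K) := by
      rw [← qPoch_one_add, add_comm, qPoch_succ]
    simp only [vwpTerm, mul_zero, qPoch_zero_left, qPoch_succ, qFall_succ, inv_one, mul_inv]
    have h1 : (1 - q * q ^ K) * (1 - q * q ^ K)⁻¹ = 1 := mul_inv_cancel₀ m0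
    rw [mul_pow (a * q) q, show q ^ (2 * K) = (q ^ K) ^ 2 by ring, pow_succ (a * q) K,
      pow_succ q K]
    linear_combination (-(1 - a * q * (q ^ K) ^ 2) * (qPoch q q K)⁻¹ *
        (qFall q 0 K * qFall q 0 K * qFall q 0 K * (a * q) ^ K) * q ^ K) * e -
      (qPoch q a K * (1 - a * q ^ K) * (qPoch q q K)⁻¹ *
        (qFall q 0 K * qFall q 0 K * qFall q 0 K * (a * q) ^ K) * (q ^ K) ^ 3 * (a * q)) * h1

theorem zero_param_ne_one (q x : ℂ) (m : ℕ) : x * 0 * q ^ m ≠ 1 := by simp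

theorem tsum_vwpTerm_zero_step {q : ℂ} (hq : ‖q‖ < 1) (a : ℂ) :
    ∑' k, vwpTerm q a 0 0 0 k = (1 - a) * ∑' k, vwpTerm q (a * q) 0 0 0 k := by
  have s1 := (summable_norm_vwpTerm hq (zero_param_ne_one q (a * q))
    (zero_param_ne_one q (a * q)) (zero_param_ne_one q (a * q)) (by simp)).of_norm.hasSum
  have s2 := (summable_norm_vwpTerm hq (zero_param_ne_one q (a * q * q))
    (zero_param_ne_one q (a * q * q)) (zero_param_ne_one q (a * q * q))
    (by simp)).of_norm.hasSum.mul_left (1 - a)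
  have s3 := (s1.sub s2).tendsto_sum_nat
  simp only [sum_range_vwpTerm_zero_sub hq] at s3
  have hp : Tendsto (fun K : ℕ => q ^ K) atTop (𝓝 0) :=
    tendsto_pow_atTop_nhds_zero_of_norm_lt_one hq
  have t2 := (tendsto_qPoch hq a).mul
    ((tendsto_qPoch hq q).inv₀ (qPochInf_ne_zero hq (self_mul_pow_ne_one hq)))
  have t5 := (t2.mul ((tendsto_const_nhds (x := (1 : ℂ))).sub hp)).neg.mul
    (tendsto_qFall_mul (β := 0) (γ := 0) (δ := 0) (a := a) hq (by simp))
  rw [mul_zero] at t5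
  exact sub_eq_zero.1 (tendsto_nhds_unique s3 t5)

theorem tsum_vwpTerm_zero_iterate {q : ℂ} (hq : ‖q‖ < 1) (a : ℂ) (N : ℕ) :
    ∑' k, vwpTerm q a 0 0 0 k = qPoch q a N * ∑' k, vwpTerm q (a * q ^ N) 0 0 0 k := by
  induction N with
  | zero => simp [qPoch_zero_right]
  | succ N ih => 
    rw [ih, tsum_vwpTerm_zero_step hq, qPoch_succ, mul_assoc a, ← pow_succ]
    ring

theorem tendsto_tsum_vwpTerm_zero {q : ℂ} (hq : ‖q‖ < 1) (a : ℂ) :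
    Tendsto (fun N : ℕ => ∑' k, vwpTerm q (a * q ^ N) 0 0 0 k) atTop (𝓝 1) := by
  obtain ⟨C, ρ, hC, hρ, hρ1, hle⟩ :=
    exists_norm_qFall_mul_le (q := q) (a := a) (β := 0) (γ := 0) (δ := 0) hq (by simp)
  obtain ⟨C₀, hC₀, h₀⟩ := exists_norm_inv_qPoch_shift_le hq (self_mul_pow_ne_one hq)
  have hN : Tendsto (fun N : ℕ => a * q ^ N) atTop (𝓝 0) := by
    simpa using (tendsto_pow_atTop_nhds_zero_of_norm_lt_one hq).const_mul a
  have key : Tendsto (fun N : ℕ => ∑' k, vwpTerm q (a * q ^ N) 0 0 0 k) atTop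
      (𝓝 (∑' k, vwpTerm q 0 0 0 0 k)) := by
    refine tendsto_tsum_of_dominated_convergence
      (bound := fun k => (1 + ‖a‖) * Real.exp (‖a‖ * (1 - ‖q‖)⁻¹) * C₀ * (C * ρ ^ k))
      (((summable_geometric_of_lt_one hρ hρ1).mul_left C).mul_left _) (fun k => ?_)
      (Eventually.of_forall fun N k => ?_)
    · have hc : Continuous fun y => vwpTerm q y 0 0 0 k := by
        simp only [vwpTerm, mul_zero, qPoch_zero_left]
        unfold qPoch
        fun_prop
      exact (hc.tendsto 0).comp hN
    · have e0 : ‖1 - a * q ^ N * q ^ (2 * k)‖ ≤ 1 + ‖a‖ := by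
        refine (norm_sub_le _ _).trans ?_
        rw [norm_one]
        linarith [norm_mul_pow_le hq (a * q ^ N) (2 * k), norm_mul_pow_le hq a N]
      have e1 := norm_qPoch_le hq (norm_mul_pow_le hq a N) k
      have e2 : ‖(qPoch q q k)⁻¹‖ ≤ C₀ := by simpa using h₀ 0 k
      have e6 := hle (a * q ^ N) 0 (norm_mul_pow_le hq a N) le_rfl k
      simp only [vwpTerm, mul_zero, qPoch_zero_left, inv_one, mul_one]
      simp only [norm_mul _ (qFall q 0 k * qFall q 0 k * qFall q 0 k * (a * q ^ N * q) ^ k),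
        norm_mul _ (qPoch q q k)⁻¹, norm_mul _ (qPoch q (a * q ^ N) k)]
      gcongr
  -- At a = 0 the factor (aq)^k leaves only k = 0.
  have h1 : ∑' k, vwpTerm q 0 0 0 0 k = 1 := by
    rw [tsum_eq_single 0 fun k hk => by simp [vwpTerm, hk]]
    simp [vwpTerm, qPoch, qFall]
  rwa [h1] at key

theorem tsum_vwpTerm_zero {q : ℂ} (hq : ‖q‖ < 1) (a : ℂ) :
    ∑' k, vwpTerm q a 0 0 0 k = qPochInf q a := by
  have t := (tendsto_qPoch hq a).mul (tendsto_tsum_vwpTerm_zero hq a)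
  simp only [← tsum_vwpTerm_zero_iterate hq, mul_one] at t
  exact tendsto_nhds_unique tendsto_const_nhds t

/-- The nonterminating very-well-poised `₆φ₅` summation. -/
theorem tsum_vwpTerm {q a β γ δ : ℂ} (hq : ‖q‖ < 1)
    (hβ : ∀ m : ℕ, a * q * β * q ^ m ≠ 1) (hγ : ∀ m : ℕ, a * q * γ * q ^ m ≠ 1)
    (hδ : ∀ m : ℕ, a * q * δ * q ^ m ≠ 1) (h : ‖a * q * (β * γ * δ)‖ < 1) :
    ∑' k, vwpTerm q a β γ δ k =
      qPochInf q a * qPochInf q (a * q * (β * γ)) * qPochInf q (a * q * (β * δ)) *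
          qPochInf q (a * q * (γ * δ)) /
        (qPochInf q (a * q * β) * qPochInf q (a * q * γ) * qPochInf q (a * q * δ) *
          qPochInf q (a * q * (β * γ * δ))) := by
  have h0 := zero_param_ne_one q (a * q)
  -- Remove δ, then γ, then β; the symmetry of the term puts the parameter to be removed in the last
  -- slot.
  have e1 := tsum_vwpTerm_eq_zero_param hq hβ hγ hδ h
  have e2 := tsum_vwpTerm_eq_zero_param hq hβ h0 hγ (by simp)
  have e3 := tsum_vwpTerm_eq_zero_param hq h0 h0 hβ (by simp)
  rw [vwpTerm_swap₂₃] at e2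
  rw [vwpTerm_swap₂₃ q a 0 0 β, vwpTerm_swap₁₂ q a 0 β 0, tsum_vwpTerm_zero hq] at e3
  simp only [mul_zero, zero_mul, qPochInf_zero, mul_one, one_mul] at e2 e3
  have nβ := qPochInf_ne_zero hq hβ
  have nγ := qPochInf_ne_zero hq hγ
  have nδ := qPochInf_ne_zero hq hδ
  have n3 := qPochInf_ne_zero hq (mul_pow_ne_one_of_norm_lt_one hq h)
  rw [eq_div_iff (by simp [nβ, nγ, nδ, n3])]
  linear_combination qPochInf q (a * q * β) * qPochInf q (a * q * γ) * e1 +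
    qPochInf q (a * q * (β * δ)) * qPochInf q (a * q * (γ * δ)) * (
      qPochInf q (a * q * β) * e2 + qPochInf q (a * q * (β * γ)) * e3)

/-! ### Multiple series of products and determinants. -/

theorem HasSum.trans_eq {ι : Type*} {f : ι → ℂ} {s t : ℂ} (h : HasSum f s) (e : s = t) :
    HasSum f t :=
  e ▸ h

theorem hasSum_mul_of_summable_norm {ι κ : Type*} {f : ι → ℂ} {g : κ → ℂ} {s t : ℂ}
    (hf : Summable fun x => ‖f x‖) (hg : Summable fun x => ‖g x‖) (hs : HasSum f s)
    (ht : HasSum g t) : HasSum (fun p : ι × κ => f p.1 * g p.2) (s * t) := by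
  have h := (summable_mul_of_summable_norm hf hg).hasSum
  rwa [← tsum_mul_tsum_of_summable_norm hf hg, hs.tsum_eq, ht.tsum_eq] at h

theorem hasSum_prod_pi {n : ℕ} {f : Fin n → ℕ → ℂ} (hf : ∀ i, Summable fun m => ‖f i m‖) :
    (Summable fun k : Fin n → ℕ => ‖∏ i, f i (k i)‖) ∧
      HasSum (fun k : Fin n → ℕ => ∏ i, f i (k i)) (∏ i, ∑' m, f i m) := by
  induction n with
  | zero =>
    refine ⟨(hasSum_fintype _).summable, ?_⟩
    simp
  | succ n ih =>
    obtain ⟨h1, h2⟩ := ih fun i => hf i.succ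
    let E : ℕ × (Fin n → ℕ) ≃ (Fin (n + 1) → ℕ) := Fin.consEquiv fun _ => ℕ
    have e : ∀ p : ℕ × (Fin n → ℕ), f 0 p.1 * ∏ i : Fin n, f i.succ (p.2 i) =
        ∏ i, f i (E p i) := fun p => by
      have hE : E p = Fin.cons p.1 p.2 := rfl
      simp only [hE, Fin.prod_univ_succ, Fin.cons_zero, Fin.cons_succ]
    constructor
    · have h4 := (hf 0).mul_norm h1
      simp only [e] at h4
      exact E.summable_iff.1 h4
    · refine E.hasSum_iff.1 ?_
      rw [Fin.prod_univ_succ]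
      have h3 := hasSum_mul_of_summable_norm (hf 0) h1 (hf 0).of_norm.hasSum h2
      simp only [e] at h3
      exact h3

/-- In the Leibniz expansion each permutation contributes a product of single series in independent
indices. -/
theorem hasSum_det {n : ℕ} {f : Fin n → Fin n → ℕ → ℂ} {s : Fin n → Fin n → ℂ}
    (hf : ∀ i j, Summable fun m => ‖f i j m‖) (hs : ∀ i j, HasSum (f i j) (s i j)) :
    HasSum (fun k : Fin n → ℕ => (Matrix.of fun i j => f i j (k i)).det)
      (Matrix.of s).det := by
  have D : ∀ M : Fin n → Fin n → ℂ, (Matrix.of M).det =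
      ∑ σ : Equiv.Perm (Fin n), (Equiv.Perm.sign σ : ℂ) * ∏ i, M i (σ i) := fun M => by
    -- Transposing lets σ act on columns, so that factor i keeps its own index k_i.
    rw [← Matrix.det_transpose, Matrix.det_apply']
    rfl
  simp only [D]
  refine hasSum_sum fun σ _ => HasSum.mul_left _ ?_
  have h := (hasSum_prod_pi fun i => hf i (σ i)).2
  simpa only [fun i => (hs i (σ i)).tsum_eq] using h

/-! ### The type C Vandermonde determinant. -/

/-- Collects the powers of q pulled out of the columns; a reversed hockey-stick sum. -/
theorem sum_choose_two_rev (r : ℕ) :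
    ∑ j : Fin r, (r - (j + 1 : ℕ)).choose 2 = r.choose 3 := by
  rw [Fin.sum_univ_eq_sum_range fun j => (r - (j + 1)).choose 2]
  rw [Finset.sum_congr rfl fun j _ => show (r - (j + 1)).choose 2 = (r - 1 - j).choose 2 by
    rw [add_comm, Nat.sub_sub], Finset.sum_range_reflect fun j => j.choose 2]
  induction r with
  | zero => simp
  | succ r ih => rw [Finset.sum_range_succ, ih, Nat.choose_succ_succ' r 2, add_comm]

/-- Factor by factor, (1 - axq^m)(x - q^m)/x = q^m(y + q^{-m} + aq^m) with y = -(x⁻¹ + ax): a monic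
polynomial in y up to a power of q. -/
theorem qPoch_mul_qFall_eq_prod {q x : ℂ} (a : ℂ) (hq : q ≠ 0) (hx : x ≠ 0) (n : ℕ) :
    qPoch q (a * x) n * qFall q x n / x ^ n = q ^ n.choose 2 *
      ∏ m ∈ Finset.range n, (x⁻¹ * -(1 + a * x ^ 2) + ((q ^ m)⁻¹ + a * q ^ m)) := by
  induction n with
  | zero => simp [qPoch, qFall]
  | succ n ih =>
    have e : q ^ (n + 1).choose 2 = q ^ n * q ^ n.choose 2 := by
      rw [Nat.choose_succ_succ' n 1, Nat.choose_one_right, pow_add]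
    have e' : qPoch q (a * x) (n + 1) * qFall q x (n + 1) / x ^ (n + 1) =
        qPoch q (a * x) n * qFall q x n / x ^ n *
          (q ^ n * (x⁻¹ * -(1 + a * x ^ 2) + ((q ^ n)⁻¹ + a * q ^ n))) := by
      rw [qPoch_succ, qFall_succ]
      field_simp
      ring
    rw [Finset.prod_range_succ, e, e', ih]
    ring

open Polynomial in
theorem det_pow_rev_eq_det_prod {R : Type*} [CommRing R] [Nontrivial R] {r : ℕ} (y : Fin r → R)
    (z : ℕ → R) :
    (Matrix.of fun i j : Fin r => y i ^ (j.rev : ℕ)).det =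
      (Matrix.of fun i j : Fin r => ∏ m ∈ Finset.range j.rev, (y i + z m)).det := by
  have h := Matrix.det_eval_matrixOfPolynomials_eq_det_vandermonde y
    (fun j => ∏ m ∈ Finset.range j, (X + C (z m)))
    (fun j => by
      rw [natDegree_prod_of_monic _ _ fun m _ => monic_X_add_C _]
      simp)
    (fun j => monic_prod_of_monic _ _ fun m _ => monic_X_add_C _)
  -- Multiplying by the sign of the reversal permutation reverses the columns on both sides.
  have h2 := congrArg (fun t => ((Equiv.Perm.sign (Fin.revPerm (n := r)) : ℤ) : R) * t) h
  simp only [← Matrix.det_permute'] at h2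
  simp only [eval_prod, eval_add, eval_X, eval_C] at h2
  exact h2

/-- The type `C` Vandermonde product as a determinant of `q`-shifted factorials. -/
theorem prod_sub_mul_eq_det (r : ℕ) {q : ℂ} (a : ℂ) (hq : q ≠ 0) {x : Fin r → ℂ}
    (hx : ∀ i, x i ≠ 0) :
    ∏ i : Fin r, ∏ j ∈ Finset.Ioi i, ((x i - x j) * (1 - a * (x i * x j))) =
      (q ^ r.choose 3)⁻¹ * ((∏ i, x i ^ (r - 1)) * (Matrix.of fun i j : Fin r =>
        qPoch q (a * x i) (r - (j + 1)) * qFall q (x i) (r - (j + 1)) /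
          x i ^ (r - (j + 1 : ℕ))).det) := by
  -- With w_i = -(1 + a x_i²), x_j w_i - x_i w_j = (x_i - x_j)(1 - a x_i x_j).
  have h1 := Matrix.det_projVandermonde x fun i => -(1 + a * x i ^ 2)
  have h2 : Matrix.projVandermonde x (fun i => -(1 + a * x i ^ 2)) = Matrix.of fun i j : Fin r =>
      x i ^ (r - 1) * (Matrix.of fun i j : Fin r =>
        ((x i)⁻¹ * -(1 + a * x i ^ 2)) ^ (j.rev : ℕ)) i j := by
    ext i j
    rw [Matrix.projVandermonde_apply, Matrix.of_apply, Matrix.of_apply, mul_pow, inv_pow,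
      ← mul_assoc]
    congr 1
    rw [eq_mul_inv_iff_mul_eq₀ (pow_ne_zero _ (hx i)), ← pow_add, Fin.val_rev]
    congr 1
    omega
  rw [h2, Matrix.det_mul_column, det_pow_rev_eq_det_prod _ fun m => (q ^ m)⁻¹ + a * q ^ m] at h1
  have h3 : (Matrix.of fun i j : Fin r => qPoch q (a * x i) (r - (j + 1)) *
      qFall q (x i) (r - (j + 1)) / x i ^ (r - (j + 1 : ℕ))) = Matrix.of fun i j : Fin r =>
      q ^ (r - (j + 1 : ℕ)).choose 2 * (Matrix.of fun i j : Fin r =>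
        ∏ m ∈ Finset.range j.rev,
          ((x i)⁻¹ * -(1 + a * x i ^ 2) + ((q ^ m)⁻¹ + a * q ^ m))) i j := by
    ext i j
    simp only [Matrix.of_apply, qPoch_mul_qFall_eq_prod a hq (hx i), Fin.val_rev]
  rw [h3, Matrix.det_mul_row, Finset.prod_pow_eq_pow_sum, sum_choose_two_rev, mul_left_comm _ _
    (Matrix.det _), inv_mul_cancel_left₀ (pow_ne_zero _ hq), h1]
  refine Finset.prod_congr rfl fun i _ => Finset.prod_congr rfl fun j _ => ?_
  ring

/-! ### Single sums weighted by a determinant entry. -/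

/-- Reversal of the order of factors; it simplifies (q)_{n+l} and later produces (bcd/a)_n. -/
theorem qFall_pow_mul (q x : ℂ) (n : ℕ) :
    qFall q (x * q ^ n) n = (-1) ^ n * q ^ n.choose 2 * qPoch q (x * q) n := by
  induction n generalizing x with
  | zero => simp [qFall, qPoch]
  | succ n ih =>
    rw [pow_succ, ← mul_assoc, qFall_mul_succ, ih, qPoch_succ, Nat.choose_succ_succ' n 1,
      Nat.choose_one_right, pow_add]
    ring

theorem qFall_mul_pow_add (q x : ℂ) (n l : ℕ) :
    qFall q (x * q ^ n) (n + l) = qFall q (x * q ^ n) n * (q ^ (n * l) * qFall q x l) := by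
  simp only [qFall, Finset.prod_range_add]
  rw [Finset.prod_congr rfl fun j _ => show x * q ^ n - q ^ (n + j) = q ^ n * (x - q ^ j) by ring,
    Finset.prod_mul_distrib, Finset.prod_const, Finset.card_range, pow_mul]

theorem qFall_pow_eq_zero (q : ℂ) {k n : ℕ} (h : k < n) : qFall q (q ^ k) n = 0 :=
  Finset.prod_eq_zero (Finset.mem_range.2 h) (sub_self _)

/-- The weight merges with the term: (a)_{n+l}(aq^{n+l})_n = (a)_{2n}(aq^{2n})_l, and `qFall q (q ^
(n + l)) n` cuts (q)_{n+l} down to (q)_l. -/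
theorem vwpTerm_add {q : ℂ} (a β γ δ : ℂ) (hq0 : q ≠ 0) (hq : ‖q‖ < 1) (n l : ℕ) :
    vwpTerm q a (β * q ^ n) (γ * q ^ n) (δ * q ^ n) (n + l) *
        (qPoch q (a * q ^ (n + l)) n * qFall q (q ^ (n + l)) n / q ^ ((n + l) * n)) =
      (-1) ^ n * q ^ n.choose 2 / q ^ (n * n) * (a * q) ^ n * qPoch q a (2 * n) *
        ((qPoch q (a * q * (β * q ^ n)) n)⁻¹ * (qPoch q (a * q * (γ * q ^ n)) n)⁻¹ *
          (qPoch q (a * q * (δ * q ^ n)) n)⁻¹) *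
        (qFall q (β * q ^ n) n * qFall q (γ * q ^ n) n * qFall q (δ * q ^ n) n) *
        vwpTerm q (a * q ^ (2 * n)) β γ δ l := by
  have eP : ∀ x : ℂ, qPoch q (a * q * (x * q ^ n)) (n + l) =
      qPoch q (a * q * (x * q ^ n)) n * qPoch q (a * q ^ (2 * n) * q * x) l := fun x => by
    rw [qPoch_add]
    congr 2
    ring
  have ea : qPoch q a (n + l) * qPoch q (a * q ^ (n + l)) n =
      qPoch q a (2 * n) * qPoch q (a * q ^ (2 * n)) l := by
    rw [← qPoch_add, ← qPoch_add]
    congr 1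
    ring
  have eq : (qPoch q q (n + l))⁻¹ * qFall q (q ^ (n + l)) n =
      (-1) ^ n * q ^ n.choose 2 * (qPoch q q l)⁻¹ := by
    have h1 := qPoch_ne_zero (self_mul_pow_ne_one hq) (l + n)
    rw [add_comm n l, pow_add, qFall_pow_mul]
    rw [qPoch_add] at h1 ⊢
    rw [mul_comm (q ^ l) q]
    have h2 := left_ne_zero_of_mul h1
    have h3 := right_ne_zero_of_mul h1
    field_simp
  have ex : (a * q) ^ (n + l) * (q ^ (n * l)) ^ 3 / q ^ ((n + l) * n) =
      (a * q) ^ n * (a * q ^ (2 * n) * q) ^ l / q ^ (n * n) := by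
    field_simp
    ring
  have e2 : a * q ^ (2 * (n + l)) = a * q ^ (2 * n) * q ^ (2 * l) := by ring
  simp only [vwpTerm, eP, qFall_mul_pow_add, e2, mul_inv]
  calc _ = (1 - a * q ^ (2 * n) * q ^ (2 * l)) *
        (qPoch q a (n + l) * qPoch q (a * q ^ (n + l)) n) *
        ((qPoch q q (n + l))⁻¹ * qFall q (q ^ (n + l)) n) *
        ((a * q) ^ (n + l) * (q ^ (n * l)) ^ 3 / q ^ ((n + l) * n)) *
        ((qPoch q (a * q * (β * q ^ n)) n)⁻¹ * (qPoch q (a * q * (γ * q ^ n)) n)⁻¹ *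
          (qPoch q (a * q * (δ * q ^ n)) n)⁻¹) *
        ((qPoch q (a * q ^ (2 * n) * q * β) l)⁻¹ * (qPoch q (a * q ^ (2 * n) * q * γ) l)⁻¹ *
          (qPoch q (a * q ^ (2 * n) * q * δ) l)⁻¹) *
        (qFall q (β * q ^ n) n * qFall q (γ * q ^ n) n * qFall q (δ * q ^ n) n) *
        (qFall q β l * qFall q γ l * qFall q δ l) := by ring
    _ = _ := by
        rw [ea, eq, ex]
        ring


theorem hasSum_vwpTerm_mul {q a β γ δ : ℂ} (hq0 : q ≠ 0) (hq : ‖q‖ < 1) (n : ℕ)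
    (hβ : ∀ m : ℕ, a * q * (β * q ^ n) * q ^ m ≠ 1)
    (hγ : ∀ m : ℕ, a * q * (γ * q ^ n) * q ^ m ≠ 1)
    (hδ : ∀ m : ℕ, a * q * (δ * q ^ n) * q ^ m ≠ 1)
    (h : ‖a * q ^ (2 * n) * q * (β * γ * δ)‖ < 1) :
    (Summable fun k => ‖vwpTerm q a (β * q ^ n) (γ * q ^ n) (δ * q ^ n) k *
        (qPoch q (a * q ^ k) n * qFall q (q ^ k) n / q ^ (k * n))‖) ∧
      HasSum (fun k => vwpTerm q a (β * q ^ n) (γ * q ^ n) (δ * q ^ n) k *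
        (qPoch q (a * q ^ k) n * qFall q (q ^ k) n / q ^ (k * n)))
      ((-1) ^ n * q ^ n.choose 2 / q ^ (n * n) * (a * q) ^ n *
        (qFall q (β * q ^ n) n * qFall q (γ * q ^ n) n * qFall q (δ * q ^ n) n) *
        (qPochInf q a * qPochInf q (a * q ^ (2 * n) * q * (β * γ)) *
            qPochInf q (a * q ^ (2 * n) * q * (β * δ)) *
            qPochInf q (a * q ^ (2 * n) * q * (γ * δ)) /
          (qPochInf q (a * q * (β * q ^ n)) * qPochInf q (a * q * (γ * q ^ n)) *
            qPochInf q (a * q * (δ * q ^ n)) *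
            qPochInf q (a * q ^ (2 * n) * q * (β * γ * δ))))) := by
  have e : ∀ x : ℂ, a * q * (x * q ^ n) * q ^ n = a * q ^ (2 * n) * q * x := fun x => by ring
  have hβ' := fun m => e β ▸ mul_shift_pow_ne_one hβ n m
  have hγ' := fun m => e γ ▸ mul_shift_pow_ne_one hγ n m
  have hδ' := fun m => e δ ▸ mul_shift_pow_ne_one hδ n m
  have hs := summable_norm_vwpTerm hq hβ' hγ' hδ' h
  constructor
  · refine (summable_nat_add_iff n).1 ?_
    simp only [add_comm _ n, vwpTerm_add a β γ δ hq0 hq, norm_mul _ (vwpTerm _ _ _ _ _ _)]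
    exact hs.mul_left _
  · have h1 := hs.of_norm.hasSum
    rw [tsum_vwpTerm hq hβ' hγ' hδ' h] at h1
    -- The first `n` terms vanish, since the weight has the factor q^k - q^k.
    refine (hasSum_nat_add_iff' n).1 ?_
    rw [Finset.sum_eq_zero fun k hk => by
      rw [qFall_pow_eq_zero q (Finset.mem_range.1 hk), mul_zero, zero_div, mul_zero], sub_zero]
    simp only [add_comm _ n, vwpTerm_add a β γ δ hq0 hq]
    have h2 := h1.mul_left ((-1) ^ n * q ^ n.choose 2 / q ^ (n * n) * (a * q) ^ n *
      qPoch q a (2 * n) * ((qPoch q (a * q * (β * q ^ n)) n)⁻¹ *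
        (qPoch q (a * q * (γ * q ^ n)) n)⁻¹ * (qPoch q (a * q * (δ * q ^ n)) n)⁻¹) *
      (qFall q (β * q ^ n) n * qFall q (γ * q ^ n) n * qFall q (δ * q ^ n) n))
    refine h2.trans_eq ?_
    rw [← qPoch_mul_qPochInf hq a (2 * n), ← qPoch_mul_qPochInf hq (a * q * (β * q ^ n)) n,
      ← qPoch_mul_qPochInf hq (a * q * (γ * q ^ n)) n,
      ← qPoch_mul_qPochInf hq (a * q * (δ * q ^ n)) n, e, e, e]
    simp only [div_eq_mul_inv, mul_inv]
    ring

theorem hasSum_vwpTerm_inv_mul {q a b c d : ℂ} (hq0 : q ≠ 0) (hq : ‖q‖ < 1) (ha : a ≠ 0)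
    (hb0 : b ≠ 0) (hc0 : c ≠ 0) (hd0 : d ≠ 0) (n : ℕ)
    (hb : ∀ m : ℕ, a * q / b * q ^ m ≠ 1) (hc : ∀ m : ℕ, a * q / c * q ^ m ≠ 1)
    (hd : ∀ m : ℕ, a * q / d * q ^ m ≠ 1) (h : ‖a * q / (b * c * d) / q ^ n‖ < 1) :
    (Summable fun k => ‖vwpTerm q a b⁻¹ c⁻¹ d⁻¹ k *
        (qPoch q (a * q ^ k) n * qFall q (q ^ k) n / (q ^ k) ^ n)‖) ∧
      HasSum (fun k => vwpTerm q a b⁻¹ c⁻¹ d⁻¹ k *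
        (qPoch q (a * q ^ k) n * qFall q (q ^ k) n / (q ^ k) ^ n))
      (qPoch q b n * qPoch q c n * qPoch q d n / qPoch q (b * c * d / a) n *
        ((1 - a) * ((qPochInf q (a * q) * qPochInf q (a * q / (b * c)) *
            qPochInf q (a * q / (b * d)) * qPochInf q (a * q / (c * d))) /
          (qPochInf q (a * q / b) * qPochInf q (a * q / c) * qPochInf q (a * q / d) *
            qPochInf q (a * q / (b * c * d)))))) := by
  have hqn : q ^ n ≠ 0 := pow_ne_zero n hq0
  -- The shift gives q^{2n} from a and q^{-n} from each inverse parameter: the triple product gains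
  -- q^{-n}, the pair products are unchanged.
  have e3 : a * q ^ (2 * n) * q * (b⁻¹ / q ^ n * (c⁻¹ / q ^ n) * (d⁻¹ / q ^ n)) =
      a * q / (b * c * d) / q ^ n := by
    field_simp
    ring
  have e2 : ∀ x y : ℂ, a * q ^ (2 * n) * q * (x⁻¹ / q ^ n * (y⁻¹ / q ^ n)) =
      a * q / (x * y) := fun x y => by
    rw [show q ^ (2 * n) = q ^ n * q ^ n by ring, div_mul_div_comm, ← mul_inv,
      div_eq_mul_inv _ (x * y)]
    field_simp
  have key := hasSum_vwpTerm_mul (a := a) (β := b⁻¹ / q ^ n) (γ := c⁻¹ / q ^ n)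
    (δ := d⁻¹ / q ^ n) hq0 hq n
  simp only [div_mul_cancel₀ _ hqn, e2, e3] at key
  simp only [← div_eq_mul_inv, pow_mul] at key
  obtain ⟨k1, k2⟩ := key hb hc hd h
  refine ⟨k1, k2.trans_eq ?_⟩
  -- The n extra leading factors of (aq^{1-n}/bcd)_∞, read backwards, give (bcd/a)_n up to sign and
  -- powers.
  have hT : qFall q (b * c * d / a)⁻¹ n =
      (-1) ^ n * q ^ n.choose 2 * qPoch q (a * q / (b * c * d) / q ^ n) n := by
    rw [show (b * c * d / a)⁻¹ = a / (b * c * d) / q ^ n * q ^ n by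
      rw [inv_div, div_mul_cancel₀ _ hqn], qFall_pow_mul]
    congr 2
    ring
  have hu : b * c * d / a ≠ 0 := by positivity
  rw [qFall_inv q hu] at hT
  have hC : q ^ n.choose 2 * q ^ n.choose 2 * q ^ n = (q ^ n) ^ n := by
    rw [← pow_add, ← pow_add, ← pow_mul]
    congr 1
    rw [← mul_two, Nat.choose_two_right, Nat.div_mul_cancel (Nat.even_mul_pred_self n).two_dvd]
    cases n with
    | zero => rfl
    | succ n =>
      rw [Nat.add_sub_cancel]
      ring
  have hT' : (qPoch q (a * q / (b * c * d) / q ^ n) n)⁻¹ =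
      (-1) ^ n * q ^ n.choose 2 * (b * c * d / a) ^ n * (qPoch q (b * c * d / a) n)⁻¹ := by
    rw [div_eq_iff (pow_ne_zero n hu)] at hT
    rw [hT]
    field_simp
  have h1 : qPochInf q a = (1 - a) * qPochInf q (a * q) := by
    simpa [qPoch] using (qPoch_mul_qPochInf hq a 1).symm
  have hm : ((-1 : ℂ) ^ n) * (-1) ^ n = 1 := by rw [← mul_pow]; simp
  have hp : (q ^ n.choose 2 * q ^ n.choose 2) / (q ^ n) ^ n * (a * q) ^ n *
      (b * c * d / a) ^ n / (b ^ n * c ^ n * d ^ n) = 1 := by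
    rw [← hC]
    field_simp
    simp only [← mul_pow]
    congr 1
    field_simp
  rw [← qPoch_mul_qPochInf hq (a * q / (b * c * d) / q ^ n) n, div_mul_cancel₀ _ hqn,
    qFall_inv q hb0, qFall_inv q hc0, qFall_inv q hd0, h1]
  calc _ = (qPoch q b n * qPoch q c n * qPoch q d n) *
        (qPoch q (a * q / (b * c * d) / q ^ n) n)⁻¹ * ((-1) ^ n * q ^ n.choose 2 / (q ^ n) ^ n *
          (a * q) ^ n / (b ^ n * c ^ n * d ^ n)) *
        ((1 - a) * ((qPochInf q (a * q) * qPochInf q (a * q / (b * c)) *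
            qPochInf q (a * q / (b * d)) * qPochInf q (a * q / (c * d))) /
          (qPochInf q (a * q / b) * qPochInf q (a * q / c) * qPochInf q (a * q / d) *
            qPochInf q (a * q / (b * c * d))))) := by
        simp only [div_eq_mul_inv, mul_inv]
        ring
    _ = (qPoch q b n * qPoch q c n * qPoch q d n) * (qPoch q (b * c * d / a) n)⁻¹ *
        ((-1) ^ n * (-1) ^ n) * ((q ^ n.choose 2 * q ^ n.choose 2) / (q ^ n) ^ n * (a * q) ^ n *
          (b * c * d / a) ^ n / (b ^ n * c ^ n * d ^ n)) *
        ((1 - a) * ((qPochInf q (a * q) * qPochInf q (a * q / (b * c)) *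
            qPochInf q (a * q / (b * d)) * qPochInf q (a * q / (c * d))) /
          (qPochInf q (a * q / b) * qPochInf q (a * q / c) * qPochInf q (a * q / d) *
            qPochInf q (a * q / (b * c * d))))) := by
        rw [hT']
        simp only [div_eq_mul_inv, mul_inv]
        ring
    _ = _ := by rw [hm, hp, mul_one, mul_one, div_eq_mul_inv _ (qPoch q (b * c * d / a) n)]

/-! ### Assembly of the multiple sum. -/

/-- The row factor x^{r-1} of the Vandermonde determinant turns the argument aq^{2-r}/bcd into the
`₆φ₅` argument aq/bcd. -/
theorem cr65_factor_eq {q a b c d : ℂ} {r : ℕ} (hr : 0 < r) (hq0 : q ≠ 0)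
    (hb0 : b ≠ 0) (hc0 : c ≠ 0) (hd0 : d ≠ 0) (k : ℕ) :
    (1 - a * q ^ (2 * k)) * (qPoch q a k * qPoch q b k * qPoch q c k * qPoch q d k) /
        ((1 - a) * (qPoch q q k * qPoch q (a * q / b) k * qPoch q (a * q / c) k *
          qPoch q (a * q / d) k)) *
        (a * q ^ (2 - (r : ℤ)) / (b * c * d)) ^ k * (q ^ k) ^ (r - 1) =
      (1 - a)⁻¹ * vwpTerm q a b⁻¹ c⁻¹ d⁻¹ k := by
  obtain ⟨s, rfl⟩ : ∃ s, r = s + 1 := ⟨r - 1, by omega⟩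
  have hz : q ^ (2 - ((s + 1 : ℕ) : ℤ)) * q ^ s = q := by
    rw [← zpow_natCast, ← zpow_add₀ hq0]
    push_cast
    ring_nf
    simp
  have hk : (a * q ^ (2 - ((s + 1 : ℕ) : ℤ)) / (b * c * d)) ^ k * (q ^ k) ^ s =
      (a * q) ^ k / (b ^ k * c ^ k * d ^ k) := by
    rw [← pow_mul, mul_comm k, pow_mul, ← mul_pow, div_mul_eq_mul_div, mul_assoc a, hz, div_pow,
      mul_pow, mul_pow (b * c), mul_pow b]
  rw [Nat.add_sub_cancel, mul_assoc, hk, vwpTerm, qFall_inv q hb0, qFall_inv q hc0,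
    qFall_inv q hd0]
  simp only [div_eq_mul_inv, mul_inv]
  ring

theorem corollary7p7 (r : ℕ) (q a : ℂ) (b c d : Fin r → ℂ)
    (hq0 : 0 < ‖q‖) (hq1 : ‖q‖ < 1)
    -- the denominators in the identity are nonzero
    (ha0 : a ≠ 0) (ha1 : a ≠ 1)
    (hb0 : ∀ i, b i ≠ 0) (hc0 : ∀ i, c i ≠ 0) (hd0 : ∀ i, d i ≠ 0)
    (hb : ∀ i, ∀ m : ℕ, a * q / b i * q ^ m ≠ 1)
    (hc : ∀ i, ∀ m : ℕ, a * q / c i * q ^ m ≠ 1)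
    (hd : ∀ i, ∀ m : ℕ, a * q / d i * q ^ m ≠ 1)
    -- the convergence condition
    (hz : ∀ i, ‖a * q ^ (2 - (r : ℤ)) / (b i * c i * d i)‖ < 1) :
    HasSum (cr65Term r q a b c d)
      ((q ^ r.choose 3)⁻¹ *
        (Matrix.of fun i j : Fin r =>
          (qPoch q (b i) (r - (j + 1)) * qPoch q (c i) (r - (j + 1)) *
              qPoch q (d i) (r - (j + 1))) /
            qPoch q (b i * c i * d i / a) (r - (j + 1))).det *
        ∏ i : Fin r,
          (qPochInf q (a * q) * qPochInf q (a * q / (b i * c i)) *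
              qPochInf q (a * q / (b i * d i)) * qPochInf q (a * q / (c i * d i))) /
            (qPochInf q (a * q / b i) * qPochInf q (a * q / c i) *
              qPochInf q (a * q / d i) * qPochInf q (a * q / (b i * c i * d i)))) := by
  have hq : q ≠ 0 := norm_pos_iff.1 hq0
  have ha : 1 - a ≠ 0 := sub_ne_zero.2 ha1.symm
  -- The argument in column j is q^j times the given one, so column 0 is the critical case and is
  -- exactly the hypothesis.
  have hn : ∀ i j : Fin r, ‖a * q / (b i * c i * d i) / q ^ (r - (j + 1 : ℕ))‖ < 1 := by
    intro i j
    have hj := j.isLt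
    have e : a * q / (b i * c i * d i) / q ^ (r - (j + 1 : ℕ)) =
        a * q ^ (2 - (r : ℤ)) / (b i * c i * d i) * q ^ (j : ℕ) := by
      have h1 : q ^ (2 - (r : ℤ)) * q ^ (j : ℕ) * q ^ (r - (j + 1 : ℕ)) = q := by
        rw [← zpow_natCast, ← zpow_natCast, ← zpow_add₀ hq, ← zpow_add₀ hq, Nat.cast_sub hj]
        push_cast
        ring_nf
        simp
      rw [div_eq_iff (pow_ne_zero _ hq)]
      conv_lhs => rw [← h1]
      ring
    rw [e]
    exact (norm_mul_pow_le hq1 _ _).trans_lt (hz i)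
  have key := fun i j : Fin r => hasSum_vwpTerm_inv_mul hq hq1 ha0 (hb0 i) (hc0 i) (hd0 i)
    (r - (j + 1)) (hb i) (hc i) (hd i) (hn i j)
  have hdet := ((hasSum_det (fun i j => (key i j).1) fun i j => (key i j).2).mul_left
    (∏ _i : Fin r, (1 - a)⁻¹)).mul_left (q ^ r.choose 3)⁻¹
  have hterm : cr65Term r q a b c d = fun k => (q ^ r.choose 3)⁻¹ * ((∏ _i : Fin r, (1 - a)⁻¹) *
      (Matrix.of fun i j : Fin r => vwpTerm q a (b i)⁻¹ (c i)⁻¹ (d i)⁻¹ (k i) *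
        (qPoch q (a * q ^ k i) (r - (j + 1)) * qFall q (q ^ k i) (r - (j + 1)) /
          (q ^ k i) ^ (r - (j + 1 : ℕ)))).det) := by
    funext k
    have hx : ∀ i, q ^ k i ≠ 0 := fun i => pow_ne_zero _ hq
    have hV := prod_sub_mul_eq_det r a hq hx
    simp only [← pow_add] at hV
    rw [cr65Term, hV, mul_assoc]
    congr 1
    rw [mul_right_comm, ← Finset.prod_mul_distrib]
    have hdc := Matrix.det_mul_column (fun i => vwpTerm q a (b i)⁻¹ (c i)⁻¹ (d i)⁻¹ (k i))
      (Matrix.of fun i j : Fin r => qPoch q (a * q ^ k i) (r - (j + 1)) *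
        qFall q (q ^ k i) (r - (j + 1)) / (q ^ k i) ^ (r - (j + 1 : ℕ)))
    simp only [Matrix.of_apply] at hdc
    rw [hdc, ← mul_assoc, ← Finset.prod_mul_distrib]
    congr 1
    refine Finset.prod_congr rfl fun i _ => ?_
    -- The index `i` itself witnesses 0 < r, which the truncated exponent `r - 1` requires.
    rw [← cr65_factor_eq i.pos hq (hb0 i) (hc0 i) (hd0 i), mul_comm]
  rw [hterm]
  refine hdet.trans_eq ?_
  have hdc := Matrix.det_mul_column (fun i => (1 - a) *
      ((qPochInf q (a * q) * qPochInf q (a * q / (b i * c i)) *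
            qPochInf q (a * q / (b i * d i)) * qPochInf q (a * q / (c i * d i))) /
          (qPochInf q (a * q / b i) * qPochInf q (a * q / c i) *
            qPochInf q (a * q / d i) * qPochInf q (a * q / (b i * c i * d i)))))
    (Matrix.of fun i j : Fin r =>
        (qPoch q (b i) (r - (j + 1)) * qPoch q (c i) (r - (j + 1)) *
            qPoch q (d i) (r - (j + 1))) /
          qPoch q (b i * c i * d i / a) (r - (j + 1)))
  simp only [Matrix.of_apply, mul_comm (_ * _) (_ / qPoch _ _ _)] at hdc
  rw [hdc, ← mul_assoc (∏ _i : Fin r, _), ← Finset.prod_mul_distrib, mul_assoc]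
  congr 1
  rw [mul_comm]
  congr 1
  refine Finset.prod_congr rfl fun i _ => ?_
  rw [inv_mul_cancel_left₀ ha]
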